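/- Conventions. For relations $R\colon X\to Y$, $S\colon Y\to Z$, $S\circ R$ is the usual relation composite (first $R$, then $S$), $\breve R$ is the converse, $R[U]$ the direct image. An allegory is an order-enriched dagger category whose hom-sets have binary meets, whose dagger is order preserving, and which satisfies the modular law $gf\wedge h\le (g\wedge hf^\dagger)f$. A morphism $f\colon C\to D$ is a map if $\mathrm{id}_C\le f^\dagger f$ and $ff^\dagger\le \mathrm{id}_D$; $\mathsf{Map}(\mathsf A)$ is the wide subcategory of maps. $\mathsf{StoneE}^{\mathsf R}$: objects are pairs $(X,E)$ with $X$ a Stone space and $E$ a closed equivalence relation on $X$; morphisms $(X,E)\to(X',E')$ are closed relations $R\colon X\to X'$ with $R\circ E=R=E'\circ R$; the identity of $(X,E)$ is $E$, composition is relation composition, hom-sets are ordered by inclusion, and $R^\dagger=\breve R$. $\mathsf{Gle}^{\mathsf R}$ is its full subcategory of Gleason spaces, i.e. those $(X,E)$ with $X$ extremally disconnected and $E[F]$ a proper closed subset for each proper closed $F\subset X$. A subordination $T\colon A\to B$ between boolean algebras is a relation with $0\,T\,0$, $1\,T\,1$; $a,b\,T\,c\Rightarrow (a\vee b)\,T\,c$;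 $a\,T\,c,d\Rightarrow a\,T\,(c\wedge d)$; $a\le b\,T\,c\le d\Rightarrow a\,T\,d$. $\mathsf{SubS5}^{\mathsf S}$: objects are pairs $(B,S)$ with $B$ a boolean algebra and $S$ a subordination on $B$ such that $a\,S\,b$ implies $a\le b$, $\neg b\,S\,\neg a$, and $a\,S\,c\,S\,b$ for some $c$; morphisms $(A,S_A)\to(B,S_B)$ are compatible subordinations, i.e. subordinations $T\colon A\to B$ with $T\circ S_A=T=S_B\circ T$; the identity of $(B,S)$ is $S$, composition is relation composition, hom-sets are ordered by reverse inclusion, and $b\,T^\dagger a$ iff $\neg a\,T\,\neg b$. $\mathsf{DeV}^{\mathsf S}$ is its full subcategory of de Vries algebras, i.e. those $(B,S)$ with $B$ complete and such that for each $a\ne0$ there is $b\neq 0$ with $b\,S\,a$. Let $\mathsf{StoneE}^{\mathsf F}=\mathsf{Map}(\mathsf{StoneE}^{\mathsf R})$ and $\mathsf{SubS5}^{\mathsf F}=\mathsf{Map}(\mathsf{SubS5}^{\mathsf S})$; let $\mathsf{Gle}$ (also written $\mathsf{Gle}^{\mathsf F}$) be the full subcategory of $\mathsf{StoneE}^{\mathsf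 F}$ on the Gleason spaces and $\mathsf{DeV}^{\mathsf F}$ the full subcategory of $\mathsf{SubS5}^{\mathsf F}$ on the de Vries algebras. Let $\mathsf{KHaus}$ be the category of compact Hausdorff spaces and continuous maps. Theorem. (1) $\mathsf{StoneE}^{\mathsf R}$, $\mathsf{Gle}^{\mathsf R}$, $\mathsf{SubS5}^{\mathsf S}$ and $\mathsf{DeV}^{\mathsf S}$ are allegories, and $\mathsf{Gle}=\mathsf{Map}(\mathsf{Gle}^{\mathsf R})$, $\mathsf{DeV}^{\mathsf F}=\mathsf{Map}(\mathsf{DeV}^{\mathsf S})$ (the evident functors, identical on objects and morphisms, are isomorphisms of categories). (2) A morphism $T\colon(A,S_A)\to(B,S_B)$ of $\mathsf{SubS5}^{\mathsf S}$ is a map if and only if (i) $a\,T\,0\Rightarrow a=0$ for all $a\in A$, and (ii) whenever $b_1\,S_B\,b_2$ there is $a\in A$ with $\neg a\,T\,\neg b_1$ and $a\,T\,b_2$. In particular, the morphisms of $\mathsf{DeV}^{\mathsf F}$ are exactly the compatible subordinations between de Vries algebras satisfying (i) and (ii); its identities are the de Vries proximities and its composition is relation composition. (3) The categories $\mathsf{KHaus}$,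 $\mathsf{StoneE}^{\mathsf F}$, $\mathsf{Gle}$, $\mathsf{SubS5}^{\mathsf F}$ and $\mathsf{DeV}^{\mathsf F}$ are equivalent. More precisely, there are equivalences $\mathcal Q\colon\mathsf{StoneE}^{\mathsf F}\to\mathsf{KHaus}$, given up to homeomorphism by $(X,E)\mapsto X/E$ and sending $R$ to the continuous map taking the class of $x$ to the class of $y$ whenever $x\,R\,y$; $\mathsf{Clop}\colon\mathsf{StoneE}^{\mathsf F}\to\mathsf{SubS5}^{\mathsf F}$, given up to isomorphism by $(X,E)\mapsto(\mathsf{Clop}(X),S_E)$ and $R\mapsto S_R$, where $U\,S_R\,V$ iff $R[U]\subseteq V$; the inclusions $\mathsf{Gle}\hookrightarrow\mathsf{StoneE}^{\mathsf F}$ and $\mathsf{DeV}^{\mathsf F}\hookrightarrow\mathsf{SubS5}^{\mathsf F}$ are equivalences; and there is an equivalence $\mathsf{Gle}\to\mathsf{DeV}^{\mathsf F}$ which, followed by the inclusion, is naturally isomorphic to the restriction of $\mathsf{Clop}$ to $\mathsf{Gle}$. -/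

import Mathlib

open CategoryTheory TopologicalSpace
open scoped SetRel

universe v u

/-! ### Order-enriched dagger categories, allegories, and their maps -/

/-- The structure of an order-enriched dagger category. -/
class DaggerOrder (A : Type u) [Category.{v} A] where
  homOrder : ∀ X Y : A, PartialOrder (X ⟶ Y)
  comp_le_comp : ∀ {X Y Z : A} {f f' : X ⟶ Y} {g g' : Y ⟶ Z},
    f ≤ f' → g ≤ g' → f ≫ g ≤ f' ≫ g'
  dagger : ∀ {X Y : A}, (X ⟶ Y) → (Y ⟶ X)
  dagger_id : ∀ X : A, dagger (𝟙 X) = 𝟙 X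
  dagger_comp : ∀ {X Y Z : A} (f : X ⟶ Y) (g : Y ⟶ Z), dagger (f ≫ g) = dagger g ≫ dagger f
  dagger_dagger : ∀ {X Y : A} (f : X ⟶ Y), dagger (dagger f) = f

namespace DaggerOrder

attribute [reducible, instance] DaggerOrder.homOrder

/-- An order-enriched dagger category is an allegory if its hom-sets have binary meets, the dagger
is monotone and the modular law `g f ∧ h ≤ (g ∧ h f†) f` holds
(`f ≫ g` is the composite written `g f` there). -/
structure IsAllegory (A : Type u) [Category.{v} A] [DaggerOrder A] : Prop where
  exists_meet : ∀ {X Y : A} (f g : X ⟶ Y), ∃ m : X ⟶ Y, IsGLB {f, g} m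
  dagger_mono : ∀ {X Y : A} {f g : X ⟶ Y}, f ≤ g → dagger f ≤ dagger g
  modular : ∀ {X Y Z : A} (f : X ⟶ Y) (g : Y ⟶ Z) (h m : X ⟶ Z) (n : Y ⟶ Z),
    IsGLB {f ≫ g, h} m → IsGLB {g, dagger f ≫ h} n → m ≤ f ≫ n

variable (A : Type u) [Category.{v} A] [DaggerOrder A]

/-- `f : X ⟶ Y` is a map if `id_X ≤ f† f` and `f f† ≤ id_Y`. -/
def maps : MorphismProperty A :=
  fun X Y f => 𝟙 X ≤ f ≫ dagger f ∧ dagger f ≫ f ≤ 𝟙 Y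

instance : (maps A).IsMultiplicative where
  id_mem X := by simp [maps, dagger_id]
  comp_mem {X Y Z} f g hf hg := by
    refine ⟨?_, ?_⟩
    · rw [dagger_comp]
      calc 𝟙 X ≤ f ≫ dagger f := hf.1
        _ = f ≫ 𝟙 Y ≫ dagger f := by simp
        _ ≤ f ≫ (g ≫ dagger g) ≫ dagger f :=
            comp_le_comp le_rfl (comp_le_comp hg.1 le_rfl)
        _ = (f ≫ g) ≫ dagger g ≫ dagger f := by simp
    · rw [dagger_comp]
      calc (dagger g ≫ dagger f) ≫ f ≫ g = dagger g ≫ (dagger f ≫ f) ≫ g := by simp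
        _ ≤ dagger g ≫ 𝟙 Y ≫ g := comp_le_comp le_rfl (comp_le_comp hf.2 le_rfl)
        _ = dagger g ≫ g := by simp
        _ ≤ 𝟙 Z := hg.2

/-- The category `Map(A)`: the wide subcategory of `A` whose morphisms are the maps. -/
abbrev MapCat := WideSubcategory (maps A)

variable {A}

/-- A full subcategory inherits order and dagger. -/
instance (P : ObjectProperty A) : DaggerOrder P.FullSubcategory where
  homOrder _ _ := PartialOrder.lift (fun f => f.hom) (fun _ _ h => P.hom_ext h)
  comp_le_comp h k := comp_le_comp (A := A) h k
  dagger f := ObjectProperty.homMk (dagger f.hom)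
  dagger_id X := P.hom_ext (dagger_id X.obj)
  dagger_comp f g := P.hom_ext (dagger_comp f.hom g.hom)
  dagger_dagger f := P.hom_ext (dagger_dagger f.hom)

/-- The property of objects of `Map(A)` given by a property of objects of `A`. -/
def onMaps (P : ObjectProperty A) : ObjectProperty (MapCat A) := fun X => P X.obj

/-- The functor, identical on objects and on morphisms, from the category of maps of a full
subcategory of `A` to the full subcategory of `Map(A)` on the same objects. -/
def mapsOfFull (P : ObjectProperty A) :
    MapCat P.FullSubcategory ⥤ (onMaps P).FullSubcategory where
  obj X := ⟨⟨X.obj.obj⟩, X.obj.property⟩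
  map f := ObjectProperty.homMk ⟨f.hom.hom, f.property⟩

end DaggerOrder

open DaggerOrder

/-- An isomorphism of categories. -/
def IsCatIso {C : Type*} {D : Type*} [Category C] [Category D] (F : C ⥤ D) : Prop :=
  ∃ G : D ⥤ C, F ⋙ G = 𝟭 C ∧ G ⋙ F = 𝟭 D

/-! ### Closed equivalence relations on Stone spaces

Relations are composed in diagrammatic order: `R ○ S` is first `R`, then `S`. -/

/-- Pairs `(X, E)` of a Stone space and a closed equivalence relation on it. -/
structure StoneER : Type (u + 1) where
  space : Profinite.{u}
  E : SetRel space space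
  isClosed : IsClosed E
  equivalence : Equivalence (fun x y => x ~[E] y)

namespace StoneER

/-- Compatible closed relations. -/
@[ext]
structure Hom (X Y : StoneER.{u}) : Type u where
  rel : SetRel X.space Y.space
  isClosed : IsClosed rel
  left_compat : X.E ○ rel = rel
  right_compat : rel ○ Y.E = rel

theorem isClosed_comp {X Y Z : Profinite.{u}} {R : SetRel X Y} {S : SetRel Y Z}
    (hR : IsClosed R) (hS : IsClosed S) : IsClosed (R ○ S) := by
  have h : IsClosed {p : (X × Z) × Y | (p.1.1, p.2) ∈ R ∧ (p.2, p.1.2) ∈ S} :=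
    (hR.preimage (by fun_prop : Continuous fun p : (X × Z) × Y => (p.1.1, p.2))).inter
      (hS.preimage (by fun_prop : Continuous fun p : (X × Z) × Y => (p.2, p.1.2)))
  convert isClosedMap_fst_of_compactSpace _ h using 1
  ext ⟨x, z⟩
  simp [SetRel.comp]

theorem E_comp_E (X : StoneER.{u}) : X.E ○ X.E = X.E := by
  ext ⟨x, z⟩
  exact ⟨fun ⟨_, h, k⟩ => X.equivalence.trans h k, fun h => ⟨x, X.equivalence.refl x, h⟩⟩

theorem E_inv (X : StoneER.{u}) : X.E.inv = X.E := by
  ext ⟨x, y⟩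
  exact ⟨fun h => X.equivalence.symm h, fun h => X.equivalence.symm h⟩

/-- The identity of `(X, E)` is `E`; composition is composition of relations. -/
instance : Category.{u} StoneER.{u} where
  Hom := Hom
  id X := ⟨X.E, X.isClosed, X.E_comp_E, X.E_comp_E⟩
  comp {X Y Z} R S := ⟨R.rel ○ S.rel, isClosed_comp R.isClosed S.isClosed,
    by rw [← SetRel.comp_assoc, R.left_compat], by rw [SetRel.comp_assoc, S.right_compat]⟩
  id_comp R := Hom.ext R.left_compat
  comp_id R := Hom.ext R.right_compat
  assoc R S T := Hom.ext (SetRel.comp_assoc _ _ _)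

theorem inv_comp {α β γ : Type*} (R : SetRel α β) (S : SetRel β γ) :
    (R ○ S).inv = S.inv ○ R.inv := by
  ext ⟨x, y⟩
  exact ⟨fun ⟨b, h, k⟩ => ⟨b, k, h⟩, fun ⟨b, h, k⟩ => ⟨b, k, h⟩⟩

/-- Hom-sets are ordered by inclusion; the dagger is the converse relation. -/
instance : DaggerOrder StoneER.{u} where
  homOrder X Y := PartialOrder.lift (fun R : Hom X Y => R.rel) (fun _ _ h => Hom.ext h)
  comp_le_comp h k := by
    rintro ⟨x, z⟩ ⟨y, hxy, hyz⟩
    exact ⟨y, h hxy, k hyz⟩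
  dagger {X Y} R := ⟨R.rel.inv, R.isClosed.preimage continuous_swap,
    by rw [← Y.E_inv, ← inv_comp, R.right_compat], by rw [← X.E_inv, ← inv_comp, R.left_compat]⟩
  dagger_id X := Hom.ext X.E_inv
  dagger_comp R S := Hom.ext (inv_comp _ _)
  dagger_dagger R := rfl

/-- Gleason spaces: `X` is extremally disconnected and `E` is irreducible. -/
def isGleason : ObjectProperty StoneER.{u} := fun X =>
  ExtremallyDisconnected X.space ∧
    ∀ F : Set X.space, IsClosed F → F ≠ Set.univ →
      IsClosed (X.E.image F) ∧ X.E.image F ≠ Set.univ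

/-- The equivalence relation of `(X, E)` as a setoid. -/
def setoid (X : StoneER.{u}) : Setoid X.space := ⟨fun x y => x ~[X.E] y, X.equivalence⟩

end StoneER

/-- The allegory of Gleason spaces. -/
abbrev GleR := StoneER.isGleason.{u}.FullSubcategory

/-- Closed equivalence relations on Stone spaces, with maps. -/
abbrev StoneEF := MapCat StoneER.{u}

/-- Gleason spaces, with maps. -/
abbrev Gle := (onMaps StoneER.isGleason.{u}).FullSubcategory

/-! ### S5-subordination algebras and de Vries algebras -/

/-- Subordination relations between boolean algebras. -/
structure IsSubordination {A B : Type*} [BooleanAlgebra A] [BooleanAlgebra B]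
    (S : SetRel A B) : Prop where
  bot_bot : ⊥ ~[S] ⊥
  top_top : ⊤ ~[S] ⊤
  sup_left : ∀ {a b : A} {c : B}, a ~[S] c → b ~[S] c → (a ⊔ b) ~[S] c
  inf_right : ∀ {a : A} {c d : B}, a ~[S] c → a ~[S] d → a ~[S] (c ⊓ d)
  mono : ∀ {a b : A} {c d : B}, a ≤ b → b ~[S] c → c ≤ d → a ~[S] d

/-- S5-subordination algebras `(B, S)`. -/
structure SubS5S : Type (u + 1) where
  alg : BoolAlg.{u}
  S : SetRel alg alg
  isSubordination : IsSubordination S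
  le_of_rel : ∀ {a b : alg}, a ~[S] b → a ≤ b
  compl_rel_compl : ∀ {a b : alg}, a ~[S] b → bᶜ ~[S] aᶜ
  interpolate : ∀ {a b : alg}, a ~[S] b → ∃ c, a ~[S] c ∧ c ~[S] b

namespace SubS5S

/-- Compatible subordinations. -/
@[ext]
structure Hom (A B : SubS5S.{u}) : Type u where
  rel : SetRel A.alg B.alg
  isSubordination : IsSubordination rel
  left_compat : A.S ○ rel = rel
  right_compat : rel ○ B.S = rel

theorem S_comp_S (A : SubS5S.{u}) : A.S ○ A.S = A.S := by
  ext ⟨a, b⟩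
  exact ⟨fun ⟨_, h, k⟩ => A.isSubordination.mono (A.le_of_rel h) k le_rfl,
    fun h => A.interpolate h⟩

theorem isSubordination_comp {A B C : Type*} [BooleanAlgebra A] [BooleanAlgebra B]
    [BooleanAlgebra C] {S : SetRel A B} {T : SetRel B C} (hS : IsSubordination S)
    (hT : IsSubordination T) : IsSubordination (S ○ T) where
  bot_bot := ⟨⊥, hS.bot_bot, hT.bot_bot⟩
  top_top := ⟨⊤, hS.top_top, hT.top_top⟩
  sup_left := fun ⟨b, h, k⟩ ⟨b', h', k'⟩ => ⟨b ⊔ b',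
    hS.sup_left (hS.mono le_rfl h le_sup_left) (hS.mono le_rfl h' le_sup_right),
    hT.sup_left k k'⟩
  inf_right := fun ⟨b, h, k⟩ ⟨b', h', k'⟩ => ⟨b ⊓ b', hS.inf_right h h',
    hT.inf_right (hT.mono inf_le_left k le_rfl) (hT.mono inf_le_right k' le_rfl)⟩
  mono := fun h ⟨b, k, l⟩ h' => ⟨b, hS.mono h k le_rfl, hT.mono le_rfl l h'⟩

/-- The identity of `(B, S)` is `S`; composition is composition of relations. -/
instance : Category.{u} SubS5S.{u} where
  Hom := Hom
  id A := ⟨A.S, A.isSubordination, A.S_comp_S, A.S_comp_S⟩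
  comp {A B C} S T := ⟨S.rel ○ T.rel, isSubordination_comp S.isSubordination T.isSubordination,
    by rw [← SetRel.comp_assoc, S.left_compat], by rw [SetRel.comp_assoc, T.right_compat]⟩
  id_comp S := Hom.ext S.left_compat
  comp_id S := Hom.ext S.right_compat
  assoc S T U := Hom.ext (SetRel.comp_assoc _ _ _)

/-- The dagger of a subordination: `b T† a` iff `¬a T ¬b`. -/
def dag {A B : Type*} [BooleanAlgebra A] [BooleanAlgebra B] (T : SetRel A B) : SetRel B A :=
  {p | p.2ᶜ ~[T] p.1ᶜ}

theorem isSubordination_dag {A B : Type*} [BooleanAlgebra A] [BooleanAlgebra B] {T : SetRel A B}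
    (hT : IsSubordination T) : IsSubordination (dag T) where
  bot_bot := by simpa [dag] using hT.top_top
  top_top := by simpa [dag] using hT.bot_bot
  sup_left := by
    intro a b c h k
    simpa [dag] using hT.inf_right h k
  inf_right := by
    intro a c d h k
    simpa [dag] using hT.sup_left h k
  mono := fun h k l => hT.mono (compl_le_compl l) k (compl_le_compl h)

theorem dag_comp {A B C : Type*} [BooleanAlgebra A] [BooleanAlgebra B] [BooleanAlgebra C]
    (S : SetRel A B) (T : SetRel B C) : dag (S ○ T) = dag T ○ dag S := by
  ext ⟨c, a⟩
  constructor
  · rintro ⟨b, h, k⟩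
    exact ⟨bᶜ, by simpa [dag] using k, by simpa [dag] using h⟩
  · rintro ⟨b, h, k⟩
    exact ⟨bᶜ, k, h⟩

theorem dag_dag {A B : Type*} [BooleanAlgebra A] [BooleanAlgebra B] (T : SetRel A B) :
    dag (dag T) = T := by
  ext ⟨a, b⟩
  simp [dag]

theorem dag_S (A : SubS5S.{u}) : dag A.S = A.S := by
  ext ⟨a, b⟩
  exact ⟨fun h => by simpa using A.compl_rel_compl h, fun h => A.compl_rel_compl h⟩

/-- Hom-sets are ordered by reverse inclusion. -/
instance : DaggerOrder SubS5S.{u} where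
  homOrder A B := PartialOrder.lift (fun T : Hom A B => OrderDual.toDual T.rel)
    (fun _ _ h => Hom.ext h)
  comp_le_comp {A B C S S' T T'} h k := by
    rintro ⟨a, c⟩ ⟨b, hab, hbc⟩
    exact ⟨b, h hab, k hbc⟩
  dagger {A B} T := ⟨dag T.rel, isSubordination_dag T.isSubordination,
    by rw [← B.dag_S, ← dag_comp, T.right_compat], by rw [← A.dag_S, ← dag_comp, T.left_compat]⟩
  dagger_id A := Hom.ext A.dag_S
  dagger_comp S T := Hom.ext (dag_comp _ _)
  dagger_dagger T := Hom.ext (dag_dag _)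

/-- De Vries algebras: `B` is complete and every `a ≠ 0` has some `b ≠ 0` with `b S a`. -/
def isDeVries : ObjectProperty SubS5S.{u} := fun A =>
  (∀ s : Set A.alg, ∃ a, IsLUB s a) ∧ ∀ a : A.alg, a ≠ ⊥ → ∃ b : A.alg, b ≠ ⊥ ∧ b ~[A.S] a

end SubS5S

/-- The allegory of de Vries algebras and compatible subordinations. -/
abbrev DeVS := SubS5S.isDeVries.{u}.FullSubcategory

/-- S5-subordination algebras, with maps. -/
abbrev SubS5F := MapCat SubS5S.{u}

/-- De Vries algebras, with maps. -/
abbrev DeVF := (onMaps SubS5S.isDeVries.{u}).FullSubcategory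

/-! ### Underlying sets and relations in the categories of maps -/

namespace StoneEF

/-- The relation underlying a morphism. -/
def rel {X Y : StoneEF.{u}} (R : X ⟶ Y) : SetRel X.obj.space Y.obj.space :=
  StoneER.Hom.rel R.hom

end StoneEF

namespace SubS5F

/-- The relation underlying a morphism. -/
def rel {A B : SubS5F.{u}} (T : A ⟶ B) : SetRel A.obj.alg B.obj.alg :=
  SubS5S.Hom.rel T.hom

end SubS5F

namespace DeVF

/-- The boolean algebra of an object. -/
abbrev alg (A : DeVF.{u}) : BoolAlg.{u} := A.obj.obj.alg

/-- The de Vries proximity of an object. -/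
abbrev prox (A : DeVF.{u}) : SetRel A.alg A.alg := A.obj.obj.S

/-- The relation underlying a morphism. -/
def rel {A B : DeVF.{u}} (T : A ⟶ B) : SetRel A.alg B.alg := SubS5F.rel T.hom

end DeVF

/-! ### Generalities on allegories -/

namespace DaggerOrder

section Transfer

universe v₁ v₂ u₁ u₂

variable {A : Type u₁} [Category.{v₁} A] [DaggerOrder A]

/-! Everything is carried by one duality. On Stone spaces, sending a closed relation `R` to the
subordination `R[U] ⊆ V` between clopens is an inclusion-reversing bijection. Compactness makes it
compatible with composition (`clopRel_comp`), makes it injective (`clopRel_subset_iff`), and puts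
every subordination in its image (`exists_clopRel_eq`). Converse corresponds to dagger. With Stone
duality for the algebras, `clopFunctor` is thus full, an order and dagger embedding, and surjective
on objects up to unitary isomorphism.

Closed relations form an allegory by direct relation calculus, and the structure is transported
along `clopFunctor` to subordinations. Maps are defined by inequalities in the same language, so the
embedding restricts to an equivalence of the categories of maps.

A map `(X, E) ⟶ (Y, E')` is the pullback of the graph of a continuous function `X/E → Y/E'`, so the
quotient functor is fully faithful. Gleason covers show that it reaches every compact Hausdorff
space, even from Gleason spaces. Hence every object of `StoneEF` is isomorphic to a Gleason space.
Clopen algebras of Gleason spaces are de Vries, so the same holds for `SubS5F` and de Vries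
algebras. -/

theorem IsAllegory.fullSubcategory (h : IsAllegory A) (P : ObjectProperty A) :
    IsAllegory P.FullSubcategory where
  exists_meet {X Y} f g := by
    obtain ⟨m, hm⟩ := h.exists_meet f.hom g.hom
    refine ⟨ObjectProperty.homMk m, ?_, ?_⟩
    · rintro x (rfl | rfl)
      · exact hm.1 (Or.inl rfl)
      · exact hm.1 (Or.inr rfl)
    · intro x hx
      refine hm.2 ?_
      rintro y (rfl | rfl)
      · exact hx (Or.inl rfl)
      · exact hx (Or.inr rfl)
  dagger_mono {X Y f g} hfg := h.dagger_mono (f := f.hom) (g := g.hom) hfg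
  modular {X Y Z} f g k m n hm hn := by
    -- The modular law speaks of arbitrary greatest lower bounds, so those of the full subcategory
    -- must be recognised as ones of `A`; the hom-sets agree.
    have key : ∀ {U V : P.FullSubcategory} (a b c : U ⟶ V), IsGLB {a, b} c →
        IsGLB {a.hom, b.hom} c.hom := by
      intro U V a b c hc
      refine ⟨?_, ?_⟩
      · rintro x (rfl | rfl)
        · exact hc.1 (Or.inl rfl)
        · exact hc.1 (Or.inr rfl)
      · intro x hx
        refine hc.2 (show (ObjectProperty.homMk x : U ⟶ V) ∈ lowerBounds {a, b} from ?_)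
        rintro y (rfl | rfl)
        · exact hx (Or.inl rfl)
        · exact hx (Or.inr rfl)
    exact h.modular f.hom g.hom k.hom m.hom n.hom (key _ _ _ hm) (key _ _ _ hn)

variable {B : Type u₂} [Category.{v₂} B] [DaggerOrder B]

/-- A functor that preserves and reflects the order of morphisms and preserves daggers. -/
structure IsDaggerOrderEmbedding (F : A ⥤ B) : Prop where
  map_le_map_iff : ∀ {X Y : A} {f g : X ⟶ Y}, F.map f ≤ F.map g ↔ f ≤ g
  map_dagger : ∀ {X Y : A} (f : X ⟶ Y), F.map (dagger f) = dagger (F.map f)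

namespace IsDaggerOrderEmbedding

variable {F : A ⥤ B} (hF : IsDaggerOrderEmbedding F)

include hF

theorem faithful : F.Faithful where
  map_injective h := le_antisymm (hF.map_le_map_iff.1 h.le) (hF.map_le_map_iff.1 h.ge)

theorem maps_map_iff {X Y : A} (f : X ⟶ Y) : maps B (F.map f) ↔ maps A f := by
  simp only [maps, ← hF.map_dagger, ← F.map_comp, ← F.map_id, hF.map_le_map_iff]

/-- The functor induced on the categories of maps. -/
@[simps]
def mapFunctor : MapCat A ⥤ MapCat B where
  obj X := ⟨F.obj X.obj⟩
  map f := ⟨F.map f.hom, (hF.maps_map_iff _).2 f.property⟩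
  map_id X := WideSubcategory.hom_ext _ (F.map_id X.obj)
  map_comp f g := WideSubcategory.hom_ext _ (F.map_comp f.hom g.hom)

theorem mapFunctor_faithful : hF.mapFunctor.Faithful where
  map_injective {X Y f g} h := by
    have := hF.faithful
    exact WideSubcategory.hom_ext _ (F.map_injective (congrArg (fun k => k.hom) h))

theorem mapFunctor_full [F.Full] : hF.mapFunctor.Full where
  map_surjective {X Y} f := by
    obtain ⟨g, hg⟩ := F.map_surjective (X := X.obj) (Y := Y.obj) f.hom
    have hf : maps B (F.map g) := hg ▸ f.property
    exact ⟨⟨g, (hF.maps_map_iff _).1 hf⟩, WideSubcategory.hom_ext _ hg⟩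

end IsDaggerOrderEmbedding

theorem maps_of_dagger_eq_inv {X Y : A} (e : X ≅ Y) (h : dagger e.hom = e.inv) :
    maps A e.hom := by
  simp [maps, h]

/-- A unitary isomorphism is an isomorphism in the category of maps. -/
def mapIso {X Y : A} (e : X ≅ Y) (h : dagger e.hom = e.inv) : (⟨X⟩ : MapCat A) ≅ ⟨Y⟩ :=
  WideSubcategory.isoMk (X := (⟨X⟩ : MapCat A)) (Y := ⟨Y⟩) e (maps_of_dagger_eq_inv e h)
    (maps_of_dagger_eq_inv e.symm (by simp [← h, dagger_dagger]))

/-- Being an allegory is transferred along full embeddings that are surjective on objects up to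
unitary isomorphism. -/
theorem IsDaggerOrderEmbedding.isAllegory {F : A ⥤ B} (hF : IsDaggerOrderEmbedding F) [F.Full]
    (hs : ∀ Y : B, ∃ (X : A) (e : F.obj X ≅ Y), dagger e.hom = e.inv) (hA : IsAllegory A) :
    IsAllegory B := by
  choose G e he using hs
  have he' : ∀ Y, dagger (e Y).inv = (e Y).hom := fun Y => by rw [← he, dagger_dagger]
  have := hF.faithful
  -- Conjugation by the chosen isomorphisms. It respects composition for any isomorphisms, but
  -- daggers only because these are unitary.
  let θ : ∀ {Y Z : B}, (Y ⟶ Z) ≃o (G Y ⟶ G Z) := fun {Y Z} =>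
    { toFun := fun f => F.preimage ((e Y).hom ≫ f ≫ (e Z).inv)
      invFun := fun f => (e Y).inv ≫ F.map f ≫ (e Z).hom
      left_inv := fun f => by simp
      right_inv := fun f => F.map_injective (by simp)
      map_rel_iff' := by
        intro f g
        simp only [Equiv.coe_fn_mk]
        rw [← hF.map_le_map_iff, F.map_preimage, F.map_preimage]
        refine ⟨fun h => ?_, fun h => comp_le_comp le_rfl (comp_le_comp h le_rfl)⟩
        simpa using comp_le_comp (le_refl (e Y).inv) (comp_le_comp h (le_refl (e Z).hom)) }
  have hθ : ∀ {Y Z : B} (f : Y ⟶ Z), F.map (θ f) = (e Y).hom ≫ f ≫ (e Z).inv :=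
    fun f => F.map_preimage _
  have θ_comp : ∀ {X Y Z : B} (f : X ⟶ Y) (g : Y ⟶ Z), θ (f ≫ g) = θ f ≫ θ g :=
    fun f g => F.map_injective (by simp [hθ])
  have θ_dagger : ∀ {X Y : B} (f : X ⟶ Y), θ (dagger f) = dagger (θ f) :=
    fun f => F.map_injective (by simp [hθ, hF.map_dagger, dagger_comp, he, he'])
  have θ_glb : ∀ {Y Z : B} (f g m : Y ⟶ Z), IsGLB {θ f, θ g} (θ m) ↔ IsGLB {f, g} m := by
    intro Y Z f g m
    rw [← Set.image_pair, OrderIso.isGLB_image, OrderIso.symm_apply_apply]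
  refine ⟨fun {Y Z} f g => ?_, fun {Y Z f g} h => ?_, fun f g h m n hm hn => ?_⟩
  · obtain ⟨m, hm⟩ := hA.exists_meet (θ f) (θ g)
    refine ⟨θ.symm m, (θ_glb _ _ _).1 ?_⟩
    rwa [OrderIso.apply_symm_apply]
  · rw [← θ.le_iff_le, θ_dagger, θ_dagger]
    exact hA.dagger_mono (θ.le_iff_le.2 h)
  · rw [← θ_glb, θ_comp] at hm
    rw [← θ_glb, θ_comp, θ_dagger] at hn
    rw [← θ.le_iff_le, θ_comp]
    exact hA.modular _ _ _ _ _ hm hn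

end Transfer

theorem isCatIso_mapsOfFull {A : Type u} [Category.{v} A] [DaggerOrder A] (P : ObjectProperty A) :
    IsCatIso (mapsOfFull P) :=
  ⟨{  obj := fun X => ⟨⟨X.obj.obj, X.property⟩⟩
      map := fun f => ⟨ObjectProperty.homMk f.hom.hom, f.hom.property⟩ }, rfl, rfl⟩

end DaggerOrder

/-! ### Closed relations and subordinations between clopen sets -/

section ClopRel

variable {X Y : Type*} [TopologicalSpace X] [TopologicalSpace Y]

/-- The subordination between clopen sets induced by a relation. -/
def clopRel (R : SetRel X Y) : SetRel (Clopens X) (Clopens Y) :=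
  {p | R.image (p.1 : Set X) ⊆ p.2}

theorem mem_clopRel {R : SetRel X Y} {U : Clopens X} {V : Clopens Y} :
    U ~[clopRel R] V ↔ ∀ x ∈ U, ∀ y, x ~[R] y → y ∈ V :=
  ⟨fun h x hx _ hxy => h ⟨x, hx, hxy⟩, fun h _ ⟨x, hx, hxy⟩ => h x hx _ hxy⟩

theorem isSubordination_clopRel (R : SetRel X Y) : IsSubordination (clopRel R) where
  bot_bot := mem_clopRel.2 fun _ hx => hx.elim
  top_top := mem_clopRel.2 fun _ _ _ _ => trivial
  sup_left h k := mem_clopRel.2 fun x hx y hxy =>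
    hx.elim (fun hx => mem_clopRel.1 h x hx y hxy) (fun hx => mem_clopRel.1 k x hx y hxy)
  inf_right h k := mem_clopRel.2 fun x hx y hxy =>
    ⟨mem_clopRel.1 h x hx y hxy, mem_clopRel.1 k x hx y hxy⟩
  mono h k l := mem_clopRel.2 fun x hx y hxy => l (mem_clopRel.1 k x (h hx) y hxy)

/-- Contraposition: both sides say that no related pair lies in `Uᶜ × V`. -/
theorem clopRel_inv (R : SetRel X Y) : clopRel R.inv = SubS5S.dag (clopRel R) := by
  ext ⟨V, U⟩
  refine mem_clopRel.trans (Iff.trans ?_ mem_clopRel.symm)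
  constructor
  · intro h x hx y hxy hy
    exact hx (h y hy x hxy)
  · intro h y hy x hxy
    by_contra hx
    exact h x hx y hxy hy

theorem clopRel_anti {R R' : SetRel X Y} (h : R ⊆ R') : clopRel R' ⊆ clopRel R := by
  rintro ⟨U, V⟩ hUV
  exact mem_clopRel.2 fun x hx y hxy => mem_clopRel.1 hUV x hx y (h hxy)

theorem isClosed_image_of_isClosed [CompactSpace X] {R : SetRel X Y} (hR : IsClosed R) {F : Set X}
    (hF : IsClosed F) : IsClosed (R.image F) := by
  have h : IsClosed (R ∩ Prod.fst ⁻¹' F) := hR.inter (hF.preimage continuous_fst)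
  convert isClosedMap_snd_of_compactSpace _ h using 1
  ext y
  constructor
  · rintro ⟨x, hx, hxy⟩
    exact ⟨(x, y), ⟨hxy, hx⟩, rfl⟩
  · rintro ⟨⟨x, y⟩, ⟨hxy, hx⟩, rfl⟩
    exact ⟨x, hx, hxy⟩

theorem isClosed_inv {R : SetRel X Y} (hR : IsClosed R) : IsClosed R.inv :=
  hR.preimage continuous_swap

/-- Every subordination between clopen sets comes from a closed relation. -/
theorem exists_clopRel_eq [CompactSpace X] [CompactSpace Y]
    {T : SetRel (Clopens X) (Clopens Y)} (hT : IsSubordination T) :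
    ∃ R : SetRel X Y, IsClosed R ∧ clopRel R = T := by
  -- The largest relation with `T ⊆ clopRel R`; compactness, used twice, gives the other inclusion.
  let R : SetRel X Y := {p | ∀ U V, p.1 ∈ U → U ~[T] V → p.2 ∈ V}
  refine ⟨R, ?_, ?_⟩
  · have : R = ⋂ (U : Clopens X) (V : Clopens Y) (_ : U ~[T] V),
        {p : X × Y | p.1 ∈ (U : Set X)ᶜ ∨ p.2 ∈ (V : Set Y)} := by
      ext ⟨x, y⟩
      simp only [Set.mem_iInter]
      exact ⟨fun h U V hUV => or_iff_not_imp_left.2 fun hx => h U V (not_not.1 hx) hUV,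
        fun h U V hx hUV => (h U V hUV).resolve_left fun hx' => hx' hx⟩
    rw [this]
    exact isClosed_iInter fun U => isClosed_iInter fun V => isClosed_iInter fun _ =>
      (U.isClopen.isOpen.isClosed_compl.preimage continuous_fst).union
        (V.isClopen.isClosed.preimage continuous_snd)
  · ext ⟨U, V⟩
    refine ⟨fun h => ?_, fun h => mem_clopRel.2 fun x hx y hxy => hxy U V hx h⟩
    -- With `x` fixed, finitely many pairs `C T W` exclude all of `Vᶜ`, and meets combine them.
    -- Joins over a finite cover of `U` then finish.
    have h1 : ∀ x ∈ U, ∃ C : Clopens X, x ∈ C ∧ C ~[T] V := by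
      intro x hx
      have hV : IsCompact ((V : Set Y)ᶜ) := V.isClopen.isOpen.isClosed_compl.isCompact
      obtain ⟨C, W, hxC, hCW, hW⟩ := hV.induction_on
        (p := fun s => ∃ (C : Clopens X) (W : Clopens Y), x ∈ C ∧ C ~[T] W ∧ s ⊆ (W : Set Y)ᶜ)
        ⟨⊤, ⊤, trivial, hT.top_top, Set.empty_subset _⟩
        (fun s t hst ⟨C, W, hx, hCW, h⟩ => ⟨C, W, hx, hCW, hst.trans h⟩)
        (fun s t ⟨C, W, hx, hCW, h⟩ ⟨C', W', hx', hCW', h'⟩ => ⟨C ⊓ C', W ⊓ W', ⟨hx, hx'⟩,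
          hT.inf_right (hT.mono inf_le_left hCW le_rfl) (hT.mono inf_le_right hCW' le_rfl),
          Set.union_subset (fun y hy hy' => h hy hy'.1) (fun y hy hy' => h' hy hy'.2)⟩)
        (fun y hy => by
          have hn : (x, y) ∉ R := fun hxy => hy (mem_clopRel.1 h x hx y hxy)
          obtain ⟨C, W, hxC, hCW, hyW⟩ :
              ∃ (C : Clopens X) (W : Clopens Y), x ∈ C ∧ C ~[T] W ∧ y ∉ W := by
            by_contra hcon
            push Not at hcon
            exact hn hcon
          exact ⟨_, mem_nhdsWithin_of_mem_nhds (W.isClopen.isClosed.isOpen_compl.mem_nhds hyW),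
            C, W, hxC, hCW, subset_rfl⟩)
      exact ⟨C, hxC, hT.mono le_rfl hCW (Set.compl_subset_compl.1 hW)⟩
    obtain ⟨C, hUC, hCV⟩ := U.isClopen.isClosed.isCompact.induction_on
      (p := fun s => ∃ C : Clopens X, s ⊆ C ∧ C ~[T] V)
      ⟨⊥, Set.empty_subset _, hT.mono le_rfl hT.bot_bot bot_le⟩
      (fun s t hst ⟨C, hC, hCV⟩ => ⟨C, hst.trans hC, hCV⟩)
      (fun s t ⟨C, hC, hCV⟩ ⟨D, hD, hDV⟩ =>
        ⟨C ⊔ D, Set.union_subset_union hC hD, hT.sup_left hCV hDV⟩)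
      (fun x hx => by
        obtain ⟨C, hxC, hCV⟩ := h1 x hx
        exact ⟨C, mem_nhdsWithin_of_mem_nhds (C.isClopen.isOpen.mem_nhds hxC), C,
          subset_rfl, hCV⟩)
    exact hT.mono hUC hCV le_rfl

variable [CompactSpace X] [T2Space X] [TotallyDisconnectedSpace X]
variable [CompactSpace Y] [T2Space Y] [TotallyDisconnectedSpace Y]

theorem exists_clopens_of_mem {O : Set X} (hO : IsOpen O) {x : X} (hx : x ∈ O) :
    ∃ U : Clopens X, x ∈ U ∧ (U : Set X) ⊆ O := by
  obtain ⟨U, hU, hxU, hUO⟩ := compact_exists_isClopen_in_isOpen hO hx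
  exact ⟨⟨U, hU⟩, hxU, hUO⟩

theorem exists_clopens_between {K O : Set X} (hK : IsCompact K) (hO : IsOpen O) (h : K ⊆ O) :
    ∃ U : Clopens X, K ⊆ U ∧ (U : Set X) ⊆ O := by
  refine hK.induction_on (p := fun s => ∃ U : Clopens X, s ⊆ U ∧ (U : Set X) ⊆ O)
    ⟨⊥, Set.empty_subset _, Set.empty_subset _⟩ ?_ ?_ ?_
  · rintro s t hst ⟨U, hU, hUO⟩
    exact ⟨U, hst.trans hU, hUO⟩
  · rintro s t ⟨U, hU, hUO⟩ ⟨V, hV, hVO⟩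
    exact ⟨U ⊔ V, Set.union_subset_union hU hV, Set.union_subset hUO hVO⟩
  · intro x hx
    obtain ⟨U, hxU, hUO⟩ := exists_clopens_of_mem hO (h hx)
    exact ⟨U, mem_nhdsWithin_of_mem_nhds (U.isClopen.isOpen.mem_nhds hxU), U, subset_rfl, hUO⟩

/-- A clopen rectangle around `(x, y)` misses `R`. This is how a closed relation is recovered from
its subordination. -/
theorem exists_clopens_of_notMem {R : SetRel X Y} (hR : IsClosed R) {x : X} {y : Y}
    (h : (x, y) ∉ R) :
    ∃ (U : Clopens X) (V : Clopens Y), x ∈ U ∧ U ~[clopRel R] V ∧ y ∉ V := by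
  obtain ⟨s, t, hs, ht, hxs, hyt, hst⟩ := isOpen_prod_iff.1 hR.isOpen_compl x y h
  obtain ⟨U, hxU, hU⟩ := exists_clopens_of_mem hs hxs
  obtain ⟨V, hyV, hV⟩ := exists_clopens_of_mem ht hyt
  refine ⟨U, Vᶜ, hxU, mem_clopRel.2 fun x hx y hxy hy => ?_, fun h => h hyV⟩
  exact hst (Set.mk_mem_prod (hU hx) (hV hy)) hxy

theorem clopRel_subset_iff {R R' : SetRel X Y} (hR' : IsClosed R') :
    clopRel R' ⊆ clopRel R ↔ R ⊆ R' := by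
  refine ⟨fun h => ?_, clopRel_anti⟩
  rintro ⟨x, y⟩ hxy
  by_contra hn
  obtain ⟨U, V, hx, hUV, hy⟩ := exists_clopens_of_notMem hR' hn
  exact hy (mem_clopRel.1 (h hUV) x hx y hxy)

theorem clopRel_injective {R R' : SetRel X Y} (hR : IsClosed R) (hR' : IsClosed R')
    (h : clopRel R = clopRel R') : R = R' :=
  ((clopRel_subset_iff hR').1 h.ge).antisymm ((clopRel_subset_iff hR).1 h.le)

end ClopRel

/-- If the composite sends `U` into `V`, the compact set `R[U]` is disjoint from the closed set of
points that `R'` relates to something outside `V`. A clopen separating them is the intermediate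
element. -/
theorem clopRel_comp {X Y Z : Type*} [TopologicalSpace X] [CompactSpace X] [TopologicalSpace Y]
    [CompactSpace Y] [T2Space Y] [TotallyDisconnectedSpace Y] [TopologicalSpace Z] [CompactSpace Z]
    {R : SetRel X Y} {R' : SetRel Y Z} (hR : IsClosed R) (hR' : IsClosed R') :
    clopRel (R ○ R') = clopRel R ○ clopRel R' := by
  ext ⟨U, V⟩
  constructor
  · intro h
    obtain ⟨W, hW, hW'⟩ := exists_clopens_between
      (isClosed_image_of_isClosed hR U.isClopen.isClosed).isCompact
      (isClosed_image_of_isClosed (isClosed_inv hR') (Vᶜ).isClopen.isClosed).isOpen_compl (by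
        rintro y ⟨x, hx, hxy⟩ ⟨z, hz, hyz⟩
        exact hz (mem_clopRel.1 h x hx z ⟨y, hxy, hyz⟩))
    refine ⟨W, hW, mem_clopRel.2 fun y hy z hyz => ?_⟩
    by_contra hz
    exact hW' hy ⟨z, hz, hyz⟩
  · rintro ⟨W, h, k⟩
    refine mem_clopRel.2 ?_
    rintro x hx z ⟨y, hxy, hyz⟩
    exact mem_clopRel.1 k y (mem_clopRel.1 h x hx y hxy) z hyz

/-! ### Stone representation -/

instance totallySeparatedSpace_primeSpectrum (R : Type*) [BooleanRing R] :
    TotallySeparatedSpace (PrimeSpectrum R) := by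
  refine totallySeparatedSpace_iff_exists_isClopen.2 fun p q hpq => ?_
  have hcl : ∀ a : R, IsClopen (PrimeSpectrum.basicOpen a : Set (PrimeSpectrum R)) :=
    fun a => PrimeSpectrum.isClopen_iff.2 ⟨a, BooleanRing.isIdempotentElem a, rfl⟩
  by_cases h : ∃ a, a ∉ p.asIdeal ∧ a ∈ q.asIdeal
  · obtain ⟨a, ha, hb⟩ := h
    exact ⟨_, hcl a, ha, fun h => h hb⟩
  · push Not at h
    obtain ⟨a, ha, hb⟩ : ∃ a, a ∉ q.asIdeal ∧ a ∈ p.asIdeal := by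
      by_contra hcon
      push Not at hcon
      refine hpq (PrimeSpectrum.ext (le_antisymm ?_ ?_))
      · exact fun a ha => by_contra fun hb => hcon a hb ha
      · exact fun a ha => by_contra fun hb => h a hb ha
    exact ⟨_, (hcl a).compl, fun h => h hb, fun h => h ha⟩

/-- Every boolean algebra is the algebra of clopen sets of a Stone space. -/
theorem exists_clopens_orderIso (A : Type u) [BooleanAlgebra A] :
    ∃ X : Profinite.{u}, Nonempty (Clopens X ≃o A) := by
  refine ⟨Profinite.of (PrimeSpectrum (AsBoolRing A)), ⟨OrderIso.symm ?_⟩⟩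
  -- All elements of a boolean ring are idempotent, and idempotents correspond to clopens of the
  -- spectrum.
  let e : A ≃ {e : AsBoolRing A // IsIdempotentElem e} :=
    toBoolRing.trans (Equiv.subtypeUnivEquiv BooleanRing.isIdempotentElem).symm
  let f : A ≃ Clopens (PrimeSpectrum (AsBoolRing A)) :=
    e.trans PrimeSpectrum.isIdempotentElemEquivClopens.toEquiv
  have hf : ∀ a b, f (a ⊓ b) = f a ⊓ f b := fun a b =>
    PrimeSpectrum.isIdempotentElemEquivClopens_mul (e a) (e b)
  exact ⟨f, fun {a b} => by rw [← inf_eq_left, ← hf, f.apply_eq_iff_eq, inf_eq_left]⟩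

/-! ### The allegory of closed equivalence relations on Stone spaces -/

namespace StoneER

/-- The meet of two compatible closed relations. -/
def meet {X Y : StoneER.{u}} (R S : X ⟶ Y) : X ⟶ Y where
  rel := R.rel ∩ S.rel
  isClosed := R.isClosed.inter S.isClosed
  left_compat := by
    ext ⟨x, y⟩
    refine ⟨fun ⟨x', h, k⟩ => ⟨?_, ?_⟩, fun h => ⟨x, X.equivalence.refl x, h⟩⟩
    · exact R.left_compat.subset ⟨x', h, k.1⟩
    · exact S.left_compat.subset ⟨x', h, k.2⟩
  right_compat := by
    ext ⟨x, y⟩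
    refine ⟨fun ⟨y', h, k⟩ => ⟨?_, ?_⟩, fun h => ⟨y, h, Y.equivalence.refl y⟩⟩
    · exact R.right_compat.subset ⟨y', h.1, k⟩
    · exact S.right_compat.subset ⟨y', h.2, k⟩

theorem isGLB_meet {X Y : StoneER.{u}} (R S : X ⟶ Y) : IsGLB {R, S} (meet R S) := by
  refine ⟨?_, ?_⟩
  · rintro T (rfl | rfl)
    · exact fun p hp => hp.1
    · exact fun p hp => hp.2
  · exact fun T hT p hp => ⟨hT (Or.inl rfl) hp, hT (Or.inr rfl) hp⟩

theorem isAllegory : IsAllegory StoneER.{u} where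
  exists_meet R S := ⟨meet R S, isGLB_meet R S⟩
  dagger_mono h _ hp := h hp
  modular R S T M N hM hN := by
    obtain rfl := hM.unique (isGLB_meet _ _)
    obtain rfl := hN.unique (isGLB_meet _ _)
    rintro ⟨x, z⟩ ⟨⟨y, hxy, hyz⟩, hxz⟩
    exact ⟨y, hxy, hyz, x, hxy, hxz⟩

end StoneER

/-! ### Subordination algebras -/

namespace SubS5S

/-- The isomorphism induced by an isomorphism of boolean algebras compatible with the
subordinations. -/
def isoOfOrderIso {A B : SubS5S.{u}} (φ : A.alg ≃o B.alg)
    (h : ∀ a b, φ a ~[B.S] φ b ↔ a ~[A.S] b) : A ≅ B where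
  hom :=
    { rel := {p | φ p.1 ~[B.S] p.2}
      isSubordination :=
        { bot_bot := by simpa using B.isSubordination.bot_bot
          top_top := by simpa using B.isSubordination.top_top
          sup_left := fun h k => by simpa using B.isSubordination.sup_left h k
          inf_right := fun h k => B.isSubordination.inf_right h k
          mono := fun h k l => B.isSubordination.mono (φ.monotone h) k l }
      left_compat := by
        ext ⟨a, b⟩
        constructor
        · rintro ⟨c, hac, hcb⟩
          exact B.isSubordination.mono (φ.monotone (A.le_of_rel hac)) hcb le_rfl
        · intro hab
          obtain ⟨c, hac, hcb⟩ := B.interpolate hab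
          obtain ⟨c, rfl⟩ := φ.surjective c
          exact ⟨c, (h _ _).1 hac, hcb⟩
      right_compat := by
        ext ⟨a, b⟩
        exact ⟨fun ⟨c, hac, hcb⟩ => B.S_comp_S.subset ⟨c, hac, hcb⟩, fun h => B.interpolate h⟩ }
  inv :=
    { rel := {p | p.1 ~[B.S] φ p.2}
      isSubordination :=
        { bot_bot := by simpa using B.isSubordination.bot_bot
          top_top := by simpa using B.isSubordination.top_top
          sup_left := fun h k => B.isSubordination.sup_left h k
          inf_right := fun h k => by simpa using B.isSubordination.inf_right h k
          mono := fun h k l => B.isSubordination.mono h k (φ.monotone l) }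
      left_compat := by
        ext ⟨a, b⟩
        exact ⟨fun ⟨c, hac, hcb⟩ => B.S_comp_S.subset ⟨c, hac, hcb⟩, fun h => B.interpolate h⟩
      right_compat := by
        ext ⟨a, b⟩
        constructor
        · rintro ⟨c, hac, hcb⟩
          exact B.isSubordination.mono le_rfl hac (φ.monotone (A.le_of_rel hcb))
        · intro hab
          obtain ⟨c, hac, hcb⟩ := B.interpolate hab
          obtain ⟨c, rfl⟩ := φ.surjective c
          exact ⟨c, hac, (h _ _).1 hcb⟩ }
  hom_inv_id := by
    refine Hom.ext ?_
    ext ⟨a, b⟩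
    refine Iff.trans ?_ (h a b)
    exact ⟨fun ⟨c, hac, hcb⟩ => B.S_comp_S.subset ⟨c, hac, hcb⟩, fun h => B.interpolate h⟩
  inv_hom_id := by
    refine Hom.ext ?_
    ext ⟨a, b⟩
    constructor
    · rintro ⟨c, hac, hcb⟩
      exact B.S_comp_S.subset ⟨φ c, hac, hcb⟩
    · intro hab
      obtain ⟨c, hac, hcb⟩ := B.interpolate hab
      obtain ⟨c, rfl⟩ := φ.surjective c
      exact ⟨c, hac, hcb⟩

theorem dagger_isoOfOrderIso {A B : SubS5S.{u}} (φ : A.alg ≃o B.alg)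
    (h : ∀ a b, φ a ~[B.S] φ b ↔ a ~[A.S] b) :
    dagger (isoOfOrderIso φ h).hom = (isoOfOrderIso φ h).inv := by
  refine Hom.ext ?_
  ext ⟨b, a⟩
  change φ aᶜ ~[B.S] bᶜ ↔ b ~[B.S] φ a
  rw [map_compl]
  exact ⟨fun h => by simpa using B.compl_rel_compl h, fun h => B.compl_rel_compl h⟩

/-- The maps of `SubS5S`. -/
theorem maps_iff {A B : SubS5S.{u}} (T : A ⟶ B) : maps SubS5S.{u} T ↔
    (∀ a : A.alg, a ~[T.rel] ⊥ → a = ⊥) ∧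
    (∀ b₁ b₂ : B.alg, b₁ ~[B.S] b₂ → ∃ a : A.alg, aᶜ ~[T.rel] b₁ᶜ ∧ a ~[T.rel] b₂) := by
  -- Since the order is reverse inclusion, the counit inequality unfolds to (ii). Only the
  -- equivalence of the unit inequality with (i) needs an argument.
  refine and_congr ?_ ⟨fun h b₁ b₂ hb => h hb, fun h p hp => h p.1 p.2 hp⟩
  constructor
  · intro h a ha
    have htop : (⊥ᶜ : A.alg) ~[T.rel] (⊥ᶜ : B.alg) := by simpa using T.isSubordination.top_top
    have : a ~[A.S] ⊥ := h ⟨⊥, ha, htop⟩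
    exact le_bot_iff.1 (A.le_of_rel this)
  · rintro h ⟨a, c⟩ ⟨b, hab, hbc⟩
    obtain ⟨a', haa', ha'b⟩ := T.left_compat.ge hab
    refine A.isSubordination.mono le_rfl haa' ?_
    -- By (i) this forces `a' ≤ c`, so `a S a'` yields `a S c`.
    have hbot : (a' ⊓ cᶜ) ~[T.rel] ⊥ := by
      have h1 : cᶜ ~[T.rel] bᶜ := hbc
      rw [← inf_compl_self b]
      exact T.isSubordination.inf_right (T.isSubordination.mono inf_le_left ha'b le_rfl)
        (T.isSubordination.mono inf_le_right h1 le_rfl)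
    exact disjoint_compl_right_iff.1 (disjoint_iff.2 (h _ hbot))

end SubS5S

/-! ### The functor of clopen sets -/

open SubS5S

/-- The algebra of clopen sets with the subordination induced by the equivalence relation. -/
def clopAlg (X : StoneER.{u}) : SubS5S.{u} where
  alg := BoolAlg.of (Clopens X.space)
  S := clopRel X.E
  isSubordination := isSubordination_clopRel _
  le_of_rel h x hx := mem_clopRel.1 h x hx x (X.equivalence.refl x)
  compl_rel_compl {U V} h := by
    have h' : clopRel X.E = SubS5S.dag (clopRel X.E) := by rw [← clopRel_inv, X.E_inv]
    rw [h'] at h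
    exact h
  interpolate h := (clopRel_comp X.isClosed X.isClosed).subset (by rwa [X.E_comp_E])

/-- The functor of clopen sets. -/
def clopFunctor : StoneER.{u} ⥤ SubS5S.{u} where
  obj := clopAlg
  map {X Y} R :=
    { rel := clopRel R.rel
      isSubordination := isSubordination_clopRel _
      left_compat :=
        (clopRel_comp X.isClosed R.isClosed).symm.trans (congrArg clopRel R.left_compat)
      right_compat :=
        (clopRel_comp R.isClosed Y.isClosed).symm.trans (congrArg clopRel R.right_compat) }
  map_comp R S := SubS5S.Hom.ext (clopRel_comp R.isClosed S.isClosed)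

theorem isDaggerOrderEmbedding_clopFunctor : IsDaggerOrderEmbedding clopFunctor.{u} where
  map_le_map_iff {_ _ _ S} := clopRel_subset_iff S.isClosed
  map_dagger R := SubS5S.Hom.ext (clopRel_inv R.rel)

instance : clopFunctor.{u}.Full where
  map_surjective {X Y} T := by
    obtain ⟨R, hR, hRT⟩ := exists_clopRel_eq T.isSubordination
    -- Compatibility of `R` is an equation between closed relations, so it can be checked on
    -- subordinations.
    refine ⟨⟨R, hR, ?_, ?_⟩, SubS5S.Hom.ext hRT⟩
    · refine clopRel_injective (StoneER.isClosed_comp X.isClosed hR) hR ?_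
      rw [clopRel_comp X.isClosed hR, hRT]
      exact T.left_compat
    · refine clopRel_injective (StoneER.isClosed_comp hR Y.isClosed) hR ?_
      rw [clopRel_comp hR Y.isClosed, hRT]
      exact T.right_compat

/-- The subordination, carried to clopens, comes from a closed relation `E`. Its axioms translate
one by one: self-duality gives symmetry, idempotence under composition gives transitivity, and `a S
b → a ≤ b` gives reflexivity. -/
theorem exists_iso_clopFunctor_obj (A : SubS5S.{u}) :
    ∃ (X : StoneER.{u}) (e : clopFunctor.obj X ≅ A), dagger e.hom = e.inv := by
  obtain ⟨X, ⟨φ⟩⟩ := exists_clopens_orderIso A.alg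
  let T : SetRel (Clopens X) (Clopens X) := {p | φ p.1 ~[A.S] φ p.2}
  have hT : IsSubordination T :=
    { bot_bot := by simpa [T] using A.isSubordination.bot_bot
      top_top := by simpa [T] using A.isSubordination.top_top
      sup_left := fun h k => by simpa [T] using A.isSubordination.sup_left h k
      inf_right := fun h k => by simpa [T] using A.isSubordination.inf_right h k
      mono := fun h k l => A.isSubordination.mono (φ.monotone h) k (φ.monotone l) }
  obtain ⟨E, hE, hET⟩ := exists_clopRel_eq hT
  have hdag : E.inv = E := by
    refine clopRel_injective (isClosed_inv hE) hE ?_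
    rw [clopRel_inv, hET]
    ext ⟨U, V⟩
    change φ Vᶜ ~[A.S] φ Uᶜ ↔ φ U ~[A.S] φ V
    rw [map_compl, map_compl]
    exact ⟨fun h => by simpa using A.compl_rel_compl h, fun h => A.compl_rel_compl h⟩
  have hcomp : E ○ E = E := by
    refine clopRel_injective (StoneER.isClosed_comp hE hE) hE ?_
    rw [clopRel_comp hE hE, hET]
    ext ⟨U, V⟩
    constructor
    · rintro ⟨W, h, k⟩
      exact A.S_comp_S.subset ⟨_, h, k⟩
    · intro h
      obtain ⟨c, hac, hcb⟩ := A.interpolate h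
      obtain ⟨c, rfl⟩ := φ.surjective c
      exact ⟨c, hac, hcb⟩
  have hrefl : ∀ x, x ~[E] x := by
    intro x
    by_contra hx
    obtain ⟨U, V, hU, hUV, hV⟩ := exists_clopens_of_notMem hE hx
    rw [hET] at hUV
    exact hV (φ.le_iff_le.1 (A.le_of_rel hUV) hU)
  let XE : StoneER.{u} := ⟨X, E, hE, hrefl, fun {x y} h => hdag.subset h,
    fun {x y z} h k => hcomp.subset ⟨y, h, k⟩⟩
  have hφ : ∀ U V : Clopens X, φ U ~[A.S] φ V ↔ U ~[clopRel E] V := by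
    intro U V
    rw [hET]
    rfl
  exact ⟨XE, isoOfOrderIso (A := clopAlg XE) φ hφ, dagger_isoOfOrderIso (A := clopAlg XE) φ hφ⟩

theorem SubS5S.isAllegory : IsAllegory SubS5S.{u} :=
  isDaggerOrderEmbedding_clopFunctor.isAllegory exists_iso_clopFunctor_obj StoneER.isAllegory

/-- The functor of clopen sets between the categories of maps. -/
abbrev clopMapFunctor : StoneEF.{u} ⥤ SubS5F.{u} :=
  isDaggerOrderEmbedding_clopFunctor.mapFunctor

instance : clopMapFunctor.{u}.IsEquivalence where
  faithful := isDaggerOrderEmbedding_clopFunctor.mapFunctor_faithful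
  full := isDaggerOrderEmbedding_clopFunctor.mapFunctor_full
  essSurj := ⟨fun A => by
    obtain ⟨X, e, he⟩ := exists_iso_clopFunctor_obj A.obj
    exact ⟨⟨X⟩, ⟨mapIso e he⟩⟩⟩

/-! ### Quotients by closed equivalence relations -/

namespace StoneER

variable (X : StoneER.{u})

theorem mk_eq_mk_iff {x y : X.space} :
    (Quotient.mk X.setoid x = Quotient.mk X.setoid y) ↔ x ~[X.E] y :=
  Quotient.eq

theorem isClosed_quotient_iff {F : Set (Quotient X.setoid)} :
    IsClosed F ↔ IsClosed (Quotient.mk X.setoid ⁻¹' F) :=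
  isQuotientMap_quotient_mk'.isClosed_preimage.symm

theorem preimage_image_mk (F : Set X.space) :
    Quotient.mk X.setoid ⁻¹' (Quotient.mk X.setoid '' F) = X.E.image F := by
  ext y
  exact ⟨fun ⟨x, hx, h⟩ => ⟨x, hx, X.mk_eq_mk_iff.1 h⟩,
    fun ⟨x, hx, h⟩ => ⟨x, hx, X.mk_eq_mk_iff.2 h⟩⟩

theorem isClosedMap_mk : IsClosedMap (Quotient.mk X.setoid) := fun F hF => by
  rw [isClosed_quotient_iff, preimage_image_mk]
  exact isClosed_image_of_isClosed X.isClosed hF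

/-- The quotient map is closed with compact fibres, hence proper. Its square is therefore closed,
and it carries the closed set `E` onto the diagonal. -/
instance : T2Space (Quotient X.setoid) := by
  have hproper : IsProperMap (Quotient.mk X.setoid) := by
    refine isProperMap_iff_isClosedMap_and_compact_fibers.2
      ⟨continuous_quotient_mk', X.isClosedMap_mk, fun y => ?_⟩
    induction y using Quotient.inductionOn with
    | h x =>
      rw [← Set.image_singleton, preimage_image_mk]
      exact (isClosed_image_of_isClosed X.isClosed isClosed_singleton).isCompact
  rw [t2_iff_isClosed_diagonal]
  convert (hproper.prodMap hproper).isClosedMap _ X.isClosed using 1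
  ext ⟨p, q⟩
  constructor
  · rintro (rfl : p = q)
    induction p using Quotient.inductionOn with
    | h x => exact ⟨(x, x), X.equivalence.refl x, rfl⟩
  · rintro ⟨⟨x, y⟩, hxy, h⟩
    rw [← h]
    exact X.mk_eq_mk_iff.2 hxy

end StoneER

namespace StoneEF

variable {X Y Z : StoneEF.{u}}

theorem exists_rel (R : X ⟶ Y) (x : X.obj.space) : ∃ y, x ~[rel R] y := by
  obtain ⟨y, hxy, _⟩ := R.property.1 (X.obj.equivalence.refl x : x ~[X.obj.E] x)
  exact ⟨y, hxy⟩

theorem E_of_rel (R : X ⟶ Y) {x : X.obj.space} {y y' : Y.obj.space} (h : x ~[rel R] y)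
    (h' : x ~[rel R] y') : y ~[Y.obj.E] y' :=
  R.property.2 ⟨x, h, h'⟩

theorem rel_of_E_left (R : X ⟶ Y) {x x' : X.obj.space} {y : Y.obj.space} (h : x ~[X.obj.E] x')
    (h' : x' ~[rel R] y) : x ~[rel R] y :=
  R.hom.left_compat.subset (show (x, y) ∈ X.obj.E ○ rel R from ⟨x', h, h'⟩)

theorem rel_of_E_right (R : X ⟶ Y) {x : X.obj.space} {y y' : Y.obj.space} (h : x ~[rel R] y)
    (h' : y ~[Y.obj.E] y') : x ~[rel R] y' :=
  R.hom.right_compat.subset (show (x, y') ∈ rel R ○ Y.obj.E from ⟨y, h, h'⟩)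

/-- The map on quotients induced by a morphism. -/
noncomputable def quotMap (R : X ⟶ Y) : Quotient X.obj.setoid → Quotient Y.obj.setoid :=
  Quotient.lift (fun x => Quotient.mk _ (exists_rel R x).choose) fun x x' h =>
    Y.obj.mk_eq_mk_iff.2 (E_of_rel R (exists_rel R x).choose_spec
      (rel_of_E_left R h (exists_rel R x').choose_spec))

theorem quotMap_mk_eq_mk_iff (R : X ⟶ Y) {x : X.obj.space} {y : Y.obj.space} :
    quotMap R (Quotient.mk _ x) = Quotient.mk _ y ↔ x ~[rel R] y := by
  refine (Y.obj.mk_eq_mk_iff).trans ⟨fun h => ?_, fun h => ?_⟩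
  · exact rel_of_E_right R (exists_rel R x).choose_spec h
  · exact E_of_rel R (exists_rel R x).choose_spec h

theorem continuous_quotMap (R : X ⟶ Y) : Continuous (quotMap R) := by
  refine continuous_iff_isClosed.2 fun F hF => ?_
  rw [StoneER.isClosed_quotient_iff] at hF ⊢
  -- Upstairs, the preimage of `F` is the image under the converse of `R` of the closed saturated
  -- set over `F`.
  convert isClosed_image_of_isClosed (isClosed_inv R.hom.isClosed) hF using 1
  ext x
  constructor
  · intro hx
    obtain ⟨y, hxy⟩ := exists_rel R x
    refine ⟨y, ?_, hxy⟩
    rwa [Set.mem_preimage, ← (quotMap_mk_eq_mk_iff R).2 hxy]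
  · rintro ⟨y, hy, hxy⟩
    rwa [Set.mem_preimage, Set.mem_preimage, (quotMap_mk_eq_mk_iff R).2 hxy]

/-- The quotient functor to compact Hausdorff spaces. -/
noncomputable def quotFunctor : StoneEF.{u} ⥤ CompHaus.{u} where
  obj X := CompHaus.of (Quotient X.obj.setoid)
  map R := CompHausLike.ofHom _ ⟨quotMap R, continuous_quotMap R⟩
  map_id X := by
    ext p
    induction p using Quotient.inductionOn with
    | h x => exact (quotMap_mk_eq_mk_iff (𝟙 X)).2 (X.obj.equivalence.refl x)
  map_comp {X Y Z} R S := by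
    ext p
    induction p using Quotient.inductionOn with
    | h x =>
      obtain ⟨y, hxy⟩ := exists_rel R x
      obtain ⟨z, hyz⟩ := exists_rel S y
      refine ((quotMap_mk_eq_mk_iff (R ≫ S)).2 ⟨y, hxy, hyz⟩).trans ?_
      refine Eq.symm ((congrArg (quotMap S) ((quotMap_mk_eq_mk_iff R).2 hxy)).trans ?_)
      exact (quotMap_mk_eq_mk_iff S).2 hyz

theorem quotFunctor_map_mk (R : X ⟶ Y) (p : Quotient X.obj.setoid) :
    quotFunctor.map R p = quotMap R p :=
  rfl

instance : quotFunctor.{u}.Faithful where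
  map_injective {X Y R S} h := by
    refine WideSubcategory.hom_ext _ (StoneER.Hom.ext ?_)
    ext ⟨x, y⟩
    refine (quotMap_mk_eq_mk_iff R).symm.trans (Iff.trans ?_ (quotMap_mk_eq_mk_iff S))
    rw [← quotFunctor_map_mk, ← quotFunctor_map_mk, h]

instance : quotFunctor.{u}.Full where
  map_surjective {X Y} f := by
    let g : Quotient X.obj.setoid → Quotient Y.obj.setoid := f
    have hg : Continuous g := f.hom.hom.continuous
    -- The graph of `g` pulled back along the two quotient maps.
    let R : X.obj ⟶ Y.obj :=
      { rel := {p | g (Quotient.mk _ p.1) = Quotient.mk _ p.2}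
        isClosed := isClosed_eq (hg.comp (continuous_quotient_mk'.comp continuous_fst))
          (continuous_quotient_mk'.comp continuous_snd)
        left_compat := by
          ext ⟨x, y⟩
          refine ⟨fun ⟨x', h, k⟩ => ?_, fun h => ⟨x, X.obj.equivalence.refl x, h⟩⟩
          exact (congrArg g (X.obj.mk_eq_mk_iff.2 h)).trans k
        right_compat := by
          ext ⟨x, y⟩
          refine ⟨fun ⟨y', h, k⟩ => ?_, fun h => ⟨y, h, Y.obj.equivalence.refl y⟩⟩
          exact h.trans (Y.obj.mk_eq_mk_iff.2 k) }
    have hR : maps StoneER R := by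
      constructor
      · rintro ⟨x, x'⟩ h
        obtain ⟨y, hy⟩ := Quotient.exists_rep (g (Quotient.mk _ x))
        exact ⟨y, hy.symm, ((congrArg g (X.obj.mk_eq_mk_iff.2 h)).symm.trans hy.symm)⟩
      · rintro ⟨y, y'⟩ ⟨x, h, k⟩
        exact Y.obj.mk_eq_mk_iff.1 (Eq.trans (Eq.symm h) k)
    refine ⟨⟨R, hR⟩, ?_⟩
    ext p
    induction p using Quotient.inductionOn with
    | h x =>
      obtain ⟨y, hy⟩ := Quotient.exists_rep (g (Quotient.mk _ x))
      exact ((quotMap_mk_eq_mk_iff (X := X) (Y := Y) ⟨R, hR⟩).2 hy.symm).trans hy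

end StoneEF

/-! ### Gleason covers -/

/-- Every compact Hausdorff space is the image of an extremally disconnected compact Hausdorff
space under an irreducible continuous map. -/
theorem exists_irreducible_cover (Y : Type u) [TopologicalSpace Y] [CompactSpace Y] [T2Space Y] :
    ∃ (G : Profinite.{u}) (f : G → Y), ExtremallyDisconnected G ∧ Continuous f ∧
      Function.Surjective f ∧ ∀ F : Set G, F ≠ Set.univ → IsClosed F → f '' F ≠ Set.univ := by
  let : TopologicalSpace (Discrete Y) := ⊥
  have : DiscreteTopology (Discrete Y) := ⟨rfl⟩
  let D := StoneCech (Discrete Y)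
  have hid : Continuous (Discrete.as : Discrete Y → Y) := continuous_of_discreteTopology
  let φ : D → Y := stoneCechExtend hid
  have hφ : Continuous φ := continuous_stoneCechExtend hid
  have hφs : Function.Surjective φ := fun y =>
    ⟨stoneCechUnit ⟨y⟩, congrFun (stoneCechExtend_extends hid) ⟨y⟩⟩
  -- Minimality of `E` among closed sets mapping onto `Y` is the irreducibility. Extremal
  -- disconnectedness will follow once `E` is a retract of the projective space `D`.
  obtain ⟨E, hE, hEφ, hmin⟩ := exists_compact_surjective_zorn_subset hφ hφs
  let f : E → Y := E.domRestrict φ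
  have hf : Continuous f := hφ.comp continuous_subtype_val
  have hfs : Function.Surjective f := by
    intro y
    obtain ⟨d, hd, rfl⟩ := hEφ.ge (Set.mem_univ y)
    exact ⟨⟨d, hd⟩, rfl⟩
  have hD : CompactT2.Projective D := StoneCech.projective
  obtain ⟨ψ, hψ, hψf⟩ := hD hφ hf hfs
  -- If `ψ` moved `e`, a small open `W` around `e` would be sent by `ψ` off itself. Since `ψ`
  -- preserves fibres over `Y`, `Wᶜ` would still map onto `Y`, contradicting minimality.
  have hret : ∀ e : E, ψ e = e := by
    intro e
    by_contra hne
    obtain ⟨U, V, hU, hV, hψU, heV, hUV⟩ := t2_separation hne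
    let W : Set E := V ∩ (fun e : E => ψ e) ⁻¹' U
    have hW : IsOpen W := hV.inter (hU.preimage (hψ.comp continuous_subtype_val))
    refine hmin Wᶜ (fun h => ?_) hW.isClosed_compl (Set.eq_univ_of_forall fun y => ?_)
    · exact (h ▸ Set.mem_univ e : e ∈ Wᶜ) ⟨heV, hψU⟩
    · obtain ⟨d, rfl⟩ := hfs y
      by_cases hd : d ∈ W
      · exact ⟨ψ d, fun h => Set.disjoint_left.1 hUV hd.2 h.1, congrFun hψf d⟩
      · exact ⟨d, hd, rfl⟩
  have hproj : CompactT2.Projective E := by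
    intro Y' Z' _ _ _ _ _ _ g q hg hq hqs
    obtain ⟨k, hk, hkq⟩ := hD (hg.comp hψ) hq hqs
    refine ⟨k ∘ Subtype.val, hk.comp continuous_subtype_val, ?_⟩
    ext e
    exact (congrFun hkq e).trans (congrArg g (hret e))
  have := hproj.extremallyDisconnected
  exact ⟨Profinite.of E, f, hproj.extremallyDisconnected, hf, hfs, hmin⟩

/-- Take the kernel of an irreducible cover `f`. If `E[F]` is everything then `f '' F` is all of
`Y`, so irreducibility of `f` is exactly what is needed. -/
theorem exists_gleason_homeomorph (Y : Type u) [TopologicalSpace Y] [CompactSpace Y] [T2Space Y] :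
    ∃ X : StoneER.{u}, StoneER.isGleason X ∧ Nonempty (Quotient X.setoid ≃ₜ Y) := by
  obtain ⟨G, f, hG, hf, hfs, hmin⟩ := exists_irreducible_cover Y
  let X : StoneER.{u} :=
    { space := G
      E := {p | f p.1 = f p.2}
      isClosed := isClosed_eq (hf.comp continuous_fst) (hf.comp continuous_snd)
      equivalence := ⟨fun _ => rfl, fun h => Eq.symm h, fun h k => Eq.trans h k⟩ }
  refine ⟨X, ⟨hG, fun F hF hne => ⟨isClosed_image_of_isClosed X.isClosed hF, fun h => ?_⟩⟩, ⟨?_⟩⟩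
  · refine hmin F hne hF (Set.eq_univ_of_forall fun y => ?_)
    obtain ⟨x, rfl⟩ := hfs y
    obtain ⟨x', hx', hxx'⟩ := h.ge (Set.mem_univ x)
    exact ⟨x', hx', hxx'⟩
  · let g : Quotient X.setoid → Y := Quotient.lift f fun _ _ h => h
    have hg : Continuous g := hf.quotient_lift _
    have hbij : Function.Bijective g := by
      refine ⟨fun p q => ?_, fun y => ?_⟩
      · induction p, q using Quotient.inductionOn₂ with
        | h x x' => exact fun h => X.mk_eq_mk_iff.2 h
      · obtain ⟨x, rfl⟩ := hfs y
        exact ⟨Quotient.mk _ x, rfl⟩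
    exact Continuous.homeoOfEquivCompactToT2 (f := Equiv.ofBijective g hbij) hg

instance : StoneEF.quotFunctor.{u}.IsEquivalence where
  essSurj := ⟨fun Y => by
    obtain ⟨X, _, ⟨e⟩⟩ := exists_gleason_homeomorph Y
    exact ⟨⟨X⟩, ⟨CompHausLike.isoOfHomeo e⟩⟩⟩

theorem exists_gleason_iso (X : StoneEF.{u}) :
    ∃ G : StoneEF.{u}, onMaps StoneER.isGleason G ∧ Nonempty (G ≅ X) := by
  obtain ⟨G, hG, ⟨e⟩⟩ := exists_gleason_homeomorph (Quotient X.obj.setoid)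
  exact ⟨⟨G⟩, hG, ⟨StoneEF.quotFunctor.preimageIso (X := ⟨G⟩) (CompHausLike.isoOfHomeo e)⟩⟩

instance : (onMaps StoneER.isGleason.{u}).ι.IsEquivalence where
  essSurj := ⟨fun X => by
    obtain ⟨G, hG, ⟨e⟩⟩ := exists_gleason_iso X
    exact ⟨⟨G, hG⟩, ⟨e⟩⟩⟩

/-! ### De Vries algebras of Gleason spaces -/

/-- The join of a family of clopens is the closure of its union, open by extremal disconnectedness.
For `U ≠ ⊥`, the set `E[Uᶜ]` is closed and proper, and a nonempty clopen `V` missing it satisfies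
`E[V] ⊆ U`. -/
theorem isDeVries_clopAlg {X : StoneER.{u}} (hX : StoneER.isGleason X) :
    SubS5S.isDeVries (clopAlg X) := by
  refine ⟨fun s => ?_, fun U hU => ?_⟩
  · let s' : Set (Clopens X.space) := s
    let O : Set X.space := ⋃ U ∈ s', (U : Set X.space)
    have hO : IsOpen O := isOpen_biUnion fun U _ => U.isClopen.isOpen
    have hcl : IsClopen (closure O) := ⟨isClosed_closure, hX.1.open_closure O hO⟩
    refine ⟨(⟨closure O, hcl⟩ : Clopens X.space), fun U hU => ?_, fun V hV => ?_⟩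
    · exact (Set.subset_biUnion_of_mem (u := fun U : Clopens X.space => (U : Set X.space))
        hU).trans subset_closure
    · exact closure_minimal (Set.iUnion₂_subset fun U hU => hV hU)
        (show Clopens X.space from V).isClopen.isClosed
  · let U' : Clopens X.space := U
    have hF : ((U' : Set X.space)ᶜ) ≠ Set.univ := by
      intro h
      exact hU (Clopens.ext (Set.compl_univ_iff.1 h) : U' = ⊥)
    obtain ⟨hcl, hne⟩ := hX.2 _ U'.isClopen.compl.isClosed hF
    obtain ⟨x, hx⟩ := (Set.ne_univ_iff_exists_notMem _).1 hne
    obtain ⟨V, hxV, hV⟩ := exists_clopens_of_mem hcl.isOpen_compl hx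
    refine ⟨V, fun h => ?_, mem_clopRel.2 fun v hv w hvw => ?_⟩
    · exact (show x ∈ (⊥ : Clopens X.space) from h ▸ hxV)
    · by_contra hw
      exact hV hv ⟨w, hw, X.equivalence.symm hvw⟩

instance : (onMaps SubS5S.isDeVries.{u}).ι.IsEquivalence where
  essSurj := ⟨fun A => by
    obtain ⟨G, hG, ⟨e⟩⟩ := exists_gleason_iso (clopMapFunctor.objPreimage A)
    exact ⟨⟨clopMapFunctor.obj G, isDeVries_clopAlg hG⟩,
      ⟨clopMapFunctor.mapIso e ≪≫ clopMapFunctor.objObjPreimageIso A⟩⟩⟩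

/-! ### Morphisms of de Vries algebras and the main theorem -/

theorem DeVF.existsUnique_rel_eq_iff (A B : DeVF.{u}) (T : SetRel A.alg B.alg) :
    (∃! f : A ⟶ B, DeVF.rel f = T) ↔
      IsSubordination T ∧ A.prox ○ T = T ∧ T ○ B.prox = T ∧
      (∀ a : A.alg, a ~[T] ⊥ → a = ⊥) ∧
      (∀ b₁ b₂ : B.alg, b₁ ~[B.prox] b₂ → ∃ a : A.alg, aᶜ ~[T] b₁ᶜ ∧ a ~[T] b₂) := by
  constructor
  · rintro ⟨f, rfl, _⟩
    exact ⟨f.hom.hom.isSubordination, f.hom.hom.left_compat, f.hom.hom.right_compat,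
      (SubS5S.maps_iff _).1 f.hom.property⟩
  · rintro ⟨hT, hl, hr, h⟩
    let T' : A.obj.obj ⟶ B.obj.obj := ⟨T, hT, hl, hr⟩
    refine ⟨ObjectProperty.homMk ⟨T', (SubS5S.maps_iff T').2 h⟩, rfl, fun g hg => ?_⟩
    exact ObjectProperty.hom_ext _ (WideSubcategory.hom_ext _ (SubS5S.Hom.ext hg))

theorem mainTheorem3 :
    -- the four relational categories are allegories
    (IsAllegory StoneER.{u} ∧ IsAllegory GleR.{u} ∧ IsAllegory SubS5S.{u} ∧ IsAllegory DeVS.{u}) ∧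
    -- `Gle` and `DeVF` are the categories of maps of `GleR` and `DeVS`
    (IsCatIso (mapsOfFull StoneER.isGleason.{u}) ∧ IsCatIso (mapsOfFull SubS5S.isDeVries.{u})) ∧
    -- explicit description of the maps of `SubS5S`
    (∀ {A B : SubS5S.{u}} (T : A ⟶ B), maps SubS5S.{u} T ↔
      (∀ a : A.alg, a ~[T.rel] ⊥ → a = ⊥) ∧
      (∀ b₁ b₂ : B.alg, b₁ ~[B.S] b₂ → ∃ a : A.alg, aᶜ ~[T.rel] b₁ᶜ ∧ a ~[T.rel] b₂)) ∧
    -- explicit description of `DeVF`: morphisms, identities and composition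
    ((∀ (A B : DeVF.{u}) (T : SetRel A.alg B.alg), (∃! f : A ⟶ B, DeVF.rel f = T) ↔
        IsSubordination T ∧ A.prox ○ T = T ∧ T ○ B.prox = T ∧
        (∀ a : A.alg, a ~[T] ⊥ → a = ⊥) ∧
        (∀ b₁ b₂ : B.alg, b₁ ~[B.prox] b₂ → ∃ a : A.alg, aᶜ ~[T] b₁ᶜ ∧ a ~[T] b₂)) ∧
      (∀ A : DeVF.{u}, DeVF.rel (𝟙 A) = A.prox) ∧
      (∀ {A B C : DeVF.{u}} (f : A ⟶ B) (g : B ⟶ C),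
        DeVF.rel (f ≫ g) = DeVF.rel f ○ DeVF.rel g)) ∧
    -- the equivalences: quotients, clopen sets, and the two inclusions
    (∃ (Q : StoneEF.{u} ≌ CompHaus.{u}) (K : StoneEF.{u} ≌ SubS5F.{u}) (K' : Gle.{u} ≌ DeVF.{u}),
      (∃ h : ∀ X : StoneEF.{u}, Quotient X.obj.setoid ≃ₜ Q.functor.obj X,
        ∀ {X Y : StoneEF.{u}} (R : X ⟶ Y) (x : X.obj.space) (y : Y.obj.space),
          x ~[StoneEF.rel R] y →
            Q.functor.map R (h X (Quotient.mk _ x)) = h Y (Quotient.mk _ y)) ∧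
      (∃ φ : ∀ X : StoneEF.{u}, Clopens X.obj.space ≃o (K.functor.obj X).obj.alg,
        (∀ (X : StoneEF.{u}) (U V : Clopens X.obj.space),
          φ X U ~[(K.functor.obj X).obj.S] φ X V ↔ X.obj.E.image (U : Set X.obj.space) ⊆ V) ∧
        ∀ {X Y : StoneEF.{u}} (R : X ⟶ Y) (U : Clopens X.obj.space) (V : Clopens Y.obj.space),
          φ X U ~[SubS5F.rel (K.functor.map R)] φ Y V ↔
            (StoneEF.rel R).image (U : Set X.obj.space) ⊆ V) ∧
      (onMaps StoneER.isGleason.{u}).ι.IsEquivalence ∧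
      (onMaps SubS5S.isDeVries.{u}).ι.IsEquivalence ∧
      Nonempty (K'.functor ⋙ (onMaps SubS5S.isDeVries.{u}).ι ≅
        (onMaps StoneER.isGleason.{u}).ι ⋙ K.functor)) := by
  refine ⟨⟨StoneER.isAllegory, StoneER.isAllegory.fullSubcategory _, SubS5S.isAllegory,
      SubS5S.isAllegory.fullSubcategory _⟩, ⟨isCatIso_mapsOfFull _, isCatIso_mapsOfFull _⟩,
    SubS5S.maps_iff, ⟨DeVF.existsUnique_rel_eq_iff, fun _ => rfl, fun _ _ => rfl⟩, ?_⟩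
  let ιG := (onMaps StoneER.isGleason.{u}).ι.asEquivalence
  let ιD := (onMaps SubS5S.isDeVries.{u}).ι.asEquivalence
  let K := clopMapFunctor.{u}.asEquivalence
  -- `K'` includes, takes clopens, then applies a quasi-inverse of the de Vries inclusion, whose
  -- counit supplies the final natural isomorphism.
  refine ⟨StoneEF.quotFunctor.asEquivalence, K, (ιG.trans K).trans ιD.symm, ?_, ?_, inferInstance,
    inferInstance, ?_⟩
  · exact ⟨fun X => Homeomorph.refl _, fun R x y h => (StoneEF.quotMap_mk_eq_mk_iff R).2 h⟩
  · exact ⟨fun X => OrderIso.refl _, fun _ _ _ => Iff.rfl, fun _ _ _ => Iff.rfl⟩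
  · exact ⟨Functor.associator _ _ _ ≪≫
      Functor.isoWhiskerLeft (ιG.trans K).functor ιD.counitIso ≪≫ Functor.rightUnitor _⟩
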